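/- The Open Colouring Axiom (OCA) is the assertion that for every separable metrizable space $X$ and every partition $[X]^2=K_0\sqcup K_1$ of its unordered pairs of distinct points with $K_0$ open, either there is an uncountable $H\subseteq X$ with $[H]^2\subseteq K_0$, or $X=\bigcup_{n\in\mathbb N}X_n$ with $[X_n]^2\subseteq K_1$ for all $n$. Let $(M_n,d_n)_{n\in\mathbb N}$ be finite metric spaces of uniformly bounded diameter and let $(N_n,\partial_n)_{n\in\mathbb N}$ be separable metric spaces. Let $M=\prod_nM_n/\mathrm{Fin}$ be the quotient of $\prod_nM_n$ by the relation $\lim_nd_n(a_n,b_n)=0$, write $[a]$ for the class of $a$, and for $S\subseteq\mathbb N$ let $d^S([a],[b])=\limsup_{n\in S}d_n(a_n,b_n)\in[0,\infty]$ (which is $0$ if $S$ is finite); define $N=\prod_nN_n/\mathrm{Fin}$ and $\partial^S$ in the same way. These pseudometrics depend only on the class of $S$ in $\mathcal P(\mathbb N)/\mathrm{Fin}$. Let $\varphi\colon M\to N$ be coordinate respecting, that is, there is an automorphism $\alpha$ of the Boolean algebra $\mathcal P(\mathbb N)/\mathrm{Fin}$ such that for all $S\in\mathcal P(\mathbb N)/\mathrm{Fin}$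 and all $x,y\in M$, $d^S(x,y)=0$ implies $\partial^{\alpha(S)}(\varphi(x),\varphi(y))=0$. Let $\Phi\colon\prod_nM_n\to\prod_nN_n$ be a lifting of $\varphi$, that is, $\varphi([a])=[\Phi(a)]$ for all $a\in\prod_nM_n$. Let $\mathcal J_{\mathrm{prod}}$ be the set of all $A\subseteq\mathbb N$ for which there are maps $h_n\colon M_n\to N_n$ $(n\in\mathbb N)$ such that $\limsup_{n\in A}\partial_n(\Phi(a)_n,h_n(a_n))=0$ for all $a=(a_n)\in\prod_nM_n$. A family of infinite subsets of $\mathbb N$ is almost disjoint if any two distinct members have finite intersection. **Proposition.** Assume OCA. If $\mathcal J_{\mathrm{prod}}\cap\mathcal A\neq\emptyset$ for every uncountable almost disjoint family $\mathcal A$, then $\mathbb N\in\mathcal J_{\mathrm{prod}}$. In other words, $\varphi$ has a lifting of product form on all of $\mathbb N$: there are maps $h_n\colon M_n\to N_n$ such that $\varphi([a])=[(h_n(a_n))_n]$ for all $a=(a_n)\in\prod_nM_n$. -/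

import Mathlib

open Filter Topology
open scoped ENNReal NNReal

namespace ReducedProd

/-! ### The Open Colouring Axiom -/

/-- The Open Colouring Axiom: if `X` is a separable metrizable space and
`[X]² = K₀ ⊔ K₁` is a partition of its unordered pairs of distinct points with `K₀` open, then
either there is an uncountable `K₀`-homogeneous subset of `X`, or `X` is a union of countably many
`K₁`-homogeneous subsets. The open set `K₀ ⊆ [X]²` is given as a symmetric open subset of `X × X`
that is disjoint from the diagonal. (A separable metrizable space has at most continuum many
points, so nothing is lost in letting `X` range over `Type`.) -/
def OCA : Prop :=
  ∀ (X : Type) [TopologicalSpace X] [TopologicalSpace.SeparableSpace X]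
    [TopologicalSpace.MetrizableSpace X] (K₀ : Set (X × X)),
    IsOpen K₀ → (∀ x y, (x, y) ∈ K₀ → (y, x) ∈ K₀) → (∀ x, (x, x) ∉ K₀) →
      (∃ H : Set X, ¬ H.Countable ∧ ∀ x ∈ H, ∀ y ∈ H, x ≠ y → (x, y) ∈ K₀) ∨
      (∃ F : ℕ → Set X, (⋃ n, F n) = Set.univ ∧
        ∀ n, ∀ x ∈ F n, ∀ y ∈ F n, x ≠ y → (x, y) ∉ K₀)

/-! ### Almost disjoint families and `𝒫(ℕ)/Fin` -/

/-- A family of infinite subsets of `ℕ`, any two distinct members of which have finite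
intersection. -/
def AlmostDisjoint (𝒜 : Set (Set ℕ)) : Prop :=
  (∀ A ∈ 𝒜, A.Infinite) ∧ ∀ A ∈ 𝒜, ∀ B ∈ 𝒜, A ≠ B → (A ∩ B).Finite

/-- Equality of subsets of `ℕ` modulo finite sets. -/
def finSetoid : Setoid (Set ℕ) where
  r A B := (A \ B).Finite ∧ (B \ A).Finite
  iseqv :=
    { refl := fun A => by simp
      symm := fun h => ⟨h.2, h.1⟩
      trans := fun {A B C} h₁ h₂ =>
        ⟨(h₁.1.union h₂.1).subset (sdiff_triangle A B C),
          (h₂.2.union h₁.2).subset (sdiff_triangle C B A)⟩ }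

/-- The Boolean algebra `𝒫(ℕ)/Fin`. -/
def PowModFin : Type := Quotient finSetoid

/-- The class of `S ⊆ ℕ` in `𝒫(ℕ)/Fin`. -/
def PowModFin.mk (S : Set ℕ) : PowModFin := Quotient.mk finSetoid S

/-- The order of `𝒫(ℕ)/Fin`: inclusion modulo finite sets. -/
instance : LE PowModFin where
  le := Quotient.lift₂ (fun A B : Set ℕ => (A \ B).Finite) (by
    intro A B A' B' hA hB
    refine propext ⟨fun h => ?_, fun h => ?_⟩
    · exact ((hA.2.union h).union hB.1).subset
        ((sdiff_triangle A' B B').trans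
          (Set.union_subset_union_left _ (sdiff_triangle A' A B)))
    · exact ((hA.1.union h).union hB.2).subset
        ((sdiff_triangle A B' B).trans
          (Set.union_subset_union_left _ (sdiff_triangle A A' B'))))

/-- `Aut(𝒫(ℕ)/Fin)`: the automorphisms of a Boolean algebra are exactly the automorphisms of its
order. -/
abbrev AutPowModFin : Type := PowModFin ≃o PowModFin

/-! ### Reduced products of metric spaces -/

section

variable {M : ℕ → Type*} [∀ n, MetricSpace (M n)]

/-- `limsup_{n ∈ S} d_n(a_n, b_n)`, with values in `[0, ∞]`; it is `0` if `S` is finite. -/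
noncomputable def limsupDist (S : Set ℕ) (a b : ∀ n, M n) : ℝ≥0∞ :=
  limsup (fun n => edist (a n) (b n)) (atTop ⊓ 𝓟 S)

theorem limsupDist_of_finite {S : Set ℕ} (hS : S.Finite) (a b : ∀ n, M n) :
    limsupDist S a b = 0 := by
  have h : (atTop : Filter ℕ) ⊓ 𝓟 S = ⊥ := by
    rw [← Nat.cofinite_eq_atTop, ← not_neBot, cofinite_inf_principal_neBot_iff]
    exact fun h => h hS
  rw [limsupDist, h, limsup_bot]
  rfl

theorem limsupDist_comm (S : Set ℕ) (a b : ∀ n, M n) :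
    limsupDist S a b = limsupDist S b a := by
  simp only [limsupDist, edist_comm]

theorem limsupDist_triangle (S : Set ℕ) (a b c : ∀ n, M n) :
    limsupDist S a c ≤ limsupDist S a b + limsupDist S b c := by
  refine ENNReal.le_of_forall_pos_le_add fun ε hε hlt => ?_
  have hε2 : (ε : ℝ≥0∞) / 2 ≠ 0 := by simp [hε.ne']
  have hab : limsupDist S a b < limsupDist S a b + ε / 2 :=
    ENNReal.lt_add_right (ne_top_of_le_ne_top hlt.ne le_self_add) hε2
  have hbc : limsupDist S b c < limsupDist S b c + ε / 2 :=
    ENNReal.lt_add_right (ne_top_of_le_ne_top hlt.ne le_add_self) hε2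
  refine limsup_le_of_le (by isBoundedDefault) ?_
  filter_upwards [eventually_lt_of_limsup_lt hab, eventually_lt_of_limsup_lt hbc] with n h₁ h₂
  calc edist (a n) (c n) ≤ edist (a n) (b n) + edist (b n) (c n) := edist_triangle ..
    _ ≤ (limsupDist S a b + ε / 2) + (limsupDist S b c + ε / 2) := add_le_add h₁.le h₂.le
    _ = limsupDist S a b + limsupDist S b c + (ε / 2 + ε / 2) := by ring
    _ = limsupDist S a b + limsupDist S b c + ε := by rw [ENNReal.add_halves]

variable (M) in
/-- The relation `a ∼ b` if and only if `lim_n d_n(a_n, b_n) = 0` on `∏_n M_n`. -/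
def redSetoid : Setoid (∀ n, M n) where
  r a b := Tendsto (fun n => dist (a n) (b n)) atTop (𝓝 0)
  iseqv :=
    { refl := fun a => by simp
      symm := fun h => by simpa only [dist_comm] using h
      trans := fun {a b c} h₁ h₂ =>
        squeeze_zero (fun _ => dist_nonneg) (fun n => dist_triangle (a n) (b n) (c n))
          (by simpa using h₁.add h₂) }

variable (M) in
/-- The reduced product `∏_n M_n / Fin`. -/
def RedProd : Type _ := Quotient (redSetoid M)

/-- The class `[a]` in the reduced product of a sequence `a ∈ ∏_n M_n`. -/
def RedProd.mk (a : ∀ n, M n) : RedProd M := Quotient.mk (redSetoid M) a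

theorem limsupDist_eq_zero_of_rel (S : Set ℕ) {a b : ∀ n, M n} (h : redSetoid M a b) :
    limsupDist S a b = 0 := by
  have h1 : Tendsto (fun n => dist (a n) (b n)) atTop (𝓝 0) := h
  have h2 : Tendsto (fun n => edist (a n) (b n)) atTop (𝓝 0) := by
    simp only [edist_dist]
    simpa using ENNReal.tendsto_ofReal h1
  refine le_antisymm ?_ bot_le
  exact (limsup_le_limsup_of_le (inf_le_left : atTop ⊓ 𝓟 S ≤ atTop)).trans h2.limsup_eq.le

/-- The pseudometric `d^S([a], [b]) = limsup_{n ∈ S} d_n(a_n, b_n)` on the reduced product. -/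
noncomputable def RedProd.pdist (S : Set ℕ) : RedProd M → RedProd M → ℝ≥0∞ :=
  Quotient.lift₂ (limsupDist S) (by
    intro a b a' b' ha hb
    have ha := limsupDist_eq_zero_of_rel S ha
    have hb := limsupDist_eq_zero_of_rel S hb
    apply le_antisymm
    · calc limsupDist S a b ≤ limsupDist S a a' + limsupDist S a' b := limsupDist_triangle ..
        _ ≤ limsupDist S a a' + (limsupDist S a' b' + limsupDist S b' b) := by
          gcongr; exact limsupDist_triangle ..
        _ = limsupDist S a' b' := by rw [ha, limsupDist_comm S b' b, hb]; simp
    · calc limsupDist S a' b' ≤ limsupDist S a' a + limsupDist S a b' := limsupDist_triangle ..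
        _ ≤ limsupDist S a' a + (limsupDist S a b + limsupDist S b b') := by
          gcongr; exact limsupDist_triangle ..
        _ = limsupDist S a b := by rw [hb, limsupDist_comm S a' a, ha]; simp)

end

/-! ### Maps between reduced products -/

section

variable {M N : ℕ → Type*} [∀ n, MetricSpace (M n)] [∀ n, MetricSpace (N n)]

/-- `φ` is coordinate respecting: there is an automorphism `α` of `𝒫(ℕ)/Fin` such that
`d^S(x, y) = 0` implies `∂^{α(S)}(φ x, φ y) = 0`. The pseudometrics depend only on the classes of
the index sets in `𝒫(ℕ)/Fin`; here `S` and `T` are representatives of a class and its image. -/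
def CoordinateRespecting (φ : RedProd M → RedProd N) : Prop :=
  ∃ α : AutPowModFin, ∀ S T : Set ℕ, α (PowModFin.mk S) = PowModFin.mk T →
    ∀ x y : RedProd M, RedProd.pdist S x y = 0 → RedProd.pdist T (φ x) (φ y) = 0

/-- `Φ` is a lifting of `φ`: `φ [a] = [Φ a]` for all `a ∈ ∏_n M_n`. -/
def IsLifting (φ : RedProd M → RedProd N) (Φ : (∀ n, M n) → ∀ n, N n) : Prop :=
  ∀ a : ∀ n, M n, φ (RedProd.mk a) = RedProd.mk (Φ a)

/-- The set `𝒥_prod^ε` of all `A ⊆ ℕ` that admit an `ε`-lifting of product form on `A`, that is, a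
sequence of maps `h_n : M_n → N_n` with `limsup_{n ∈ A} ∂_n(Φ(a)_n, h_n(a_n)) ≤ ε` for all
`a ∈ ∏_n M_n`. -/
def JProdEps (Φ : (∀ n, M n) → ∀ n, N n) (ε : ℝ≥0) : Set (Set ℕ) :=
  {A | ∃ h : ∀ n, M n → N n, ∀ a : ∀ n, M n,
    limsupDist A (Φ a) (fun n => h n (a n)) ≤ (ε : ℝ≥0∞)}

/-- `𝒥_prod = 𝒥_prod^0`. -/
def JProd (Φ : (∀ n, M n) → ∀ n, N n) : Set (Set ℕ) := JProdEps Φ 0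

end

end ReducedProd

/-!
For `A ∈ JProd Φ` fix maps `h n` that lift `Φ` on `A`. Up to small errors they can be coded by a
point of Baire space, since `M n` is finite and `N n` separable; the set of all codes that lift `Φ`
on their domain is denoted by `H` below. Any two of them agree asymptotically on the intersection of
their domains (`Lifts.eventually_dist_le`), and the task is to find one sequence `g` that agrees
asymptotically with all of them. It suffices to do this up to an arbitrary `θ > 0` and then to
diagonalize (`exists_product_lifting`). As every infinite set contains an infinite member of
`JProd Φ`, the sequence `g` lifts `Φ` on all of `ℕ`.

*Use of the Open Colouring Axiom.* It is shown that `H` is a countable union of sets of codes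
no two of which differ anywhere by more than `θ` (`sigmaCovered_not_differ`). The axiom is applied
to `H × (ℕ → W × Bool)`, where the second factor is a space of generic branches with labels in a
countable set `W`. Two points have the open colour if their branches split at a node `u`, have the
same label there, and their codes are in an open relation depending on `u` and this label, for
example "they differ at all coordinates listed in the label". By the Baire category theorem a
covering by countably many sets without pairs of the open colour induces a similar covering of `H`.
Otherwise there is an uncountable homogeneous set, and then the labels depend only on the nodes of
an at most binary tree (`exists_isBranching`).

*The contradiction.* Suppose that the codes splitting at `u` differ at a coordinate `μ u` and a point
of `M (μ u)` depending only on `u`, and that `μ` is injective. Then one sequence `a` passes through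
all these points, all the codes agree asymptotically with `Φ a`, and so there are only countably many
of them (`countable_of_differ`). Injectivity of `μ` is achieved in two steps.

* If the labels list sufficiently many coordinates, `μ` is obtained from Hall's marriage theorem.
  Hence `H` is a countable union of sets in each of which the number of coordinates at which two
  codes can differ is bounded (`sigmaCovered_boundedly_many_differ`).
* In a set in which no two codes differ by more than `θ / 2` at `j + 1` coordinates, let the labels
  list exactly `j` such coordinates, hence all of them, with `μ u` one of these. A common value of
  `μ` at incomparable nodes would be a further coordinate of this kind for codes that split at an
  earlier node. This lowers the bound (`DifferFree.sigmaCovered`), and induction removes the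
  differences altogether.

*From the covering to `g`.* Each piece of the covering defines a candidate for `g`. If every candidate
failed on some infinite set, then a code with a domain meeting all these sets in infinite sets,
which exists by `exists_almostDisjoint_inter_infinite`, would belong to no piece
(`exists_uniform_approx`).
-/

namespace ReducedProd

/-! ### Branching sets of codes from the Open Colouring Axiom -/

/-- The list of the first `l` values of `p`. -/
def initSeg {V : Type*} (p : ℕ → V) (l : ℕ) : List V := (List.range l).map p

theorem initSeg_eq_iff {V : Type*} {p q : ℕ → V} {l : ℕ} :
    initSeg p l = initSeg q l ↔ ∀ i < l, p i = q i := by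
  simp [initSeg, List.map_inj_left]

@[simp] theorem length_initSeg {V : Type*} (p : ℕ → V) (l : ℕ) : (initSeg p l).length = l := by
  simp [initSeg]

theorem mem_initSeg {V : Type*} {p : ℕ → V} {k l : ℕ} (h : k < l) : p k ∈ initSeg p l :=
  List.mem_map.2 ⟨k, List.mem_range.2 h, rfl⟩

theorem eventually_initSeg_eq {V : Type*} [TopologicalSpace V] [DiscreteTopology V]
    (p : ℕ → V) (l : ℕ) : ∀ᶠ q in 𝓝 p, initSeg q l = initSeg p l := by
  have h : ∀ᶠ q in 𝓝 p, ∀ i ∈ Finset.range l, q i = p i := by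
    rw [Finset.eventually_all]
    intro i _
    exact (continuous_apply i).continuousAt.eventually_mem
      ((isOpen_discrete {p i}).mem_nhds rfl)
  filter_upwards [h] with q hq
  exact initSeg_eq_iff.2 fun i hi => hq i (Finset.mem_range.2 hi)

theorem exists_initSeg_subset_of_mem_nhds {V : Type*} [TopologicalSpace V] [DiscreteTopology V]
    {p : ℕ → V} {U : Set (ℕ → V)} (hU : U ∈ 𝓝 p) :
    ∃ l, ∀ q, initSeg q l = initSeg p l → q ∈ U := by
  obtain ⟨O, hOU, hO, hpO⟩ := mem_nhds_iff.1 hU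
  obtain ⟨_, ⟨x, n, rfl⟩, hp, hsub⟩ :=
    (PiNat.isTopologicalBasis_cylinders (fun _ : ℕ => V)).exists_subset_of_mem_open hpO hO
  refine ⟨n, fun q hq => hOU (hsub ?_)⟩
  rw [PiNat.mem_cylinder_iff] at hp ⊢
  exact fun i hi => (initSeg_eq_iff.1 hq i hi).trans (hp i hi)

/-- `H` is covered by countably many sets with the property `p`. -/
def SigmaCovered {X : Type*} (H : Set X) (p : Set X → Prop) : Prop :=
  ∃ 𝒞 : Set (Set X), 𝒞.Countable ∧ H ⊆ ⋃₀ 𝒞 ∧ ∀ F ∈ 𝒞, p F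

theorem SigmaCovered.bind {X : Type*} {H : Set X} {p q : Set X → Prop} (h : SigmaCovered H p)
    (hpq : ∀ F, p F → SigmaCovered F q) : SigmaCovered H q := by
  obtain ⟨𝒞, hc, hH, hp⟩ := h
  choose! 𝒟 hDc hDH hDq using fun F (hF : F ∈ 𝒞) => hpq F (hp F hF)
  refine ⟨⋃ F ∈ 𝒞, 𝒟 F, hc.biUnion hDc, fun x hx => ?_, fun G hG => ?_⟩
  · obtain ⟨F, hF, hxF⟩ := hH hx
    obtain ⟨G, hG, hxG⟩ := hDH F hF hxF
    exact ⟨G, Set.mem_biUnion hF hG, hxG⟩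
  · obtain ⟨F, hF, hG⟩ := Set.mem_iUnion₂.1 hG
    exact hDq F hF G hG

theorem sigmaCovered_of_forall_exists {X ι : Type*} [Countable ι] {H : Set X} {p : Set X → Prop}
    (G : ι → Set X) (hH : ∀ x ∈ H, ∃ i, x ∈ G i) (hp : ∀ i, p (G i)) : SigmaCovered H p :=
  ⟨Set.range G, Set.countable_range G, fun x hx => by
    obtain ⟨i, hi⟩ := hH x hx
    exact ⟨G i, ⟨i, rfl⟩, hi⟩, by rintro _ ⟨i, rfl⟩; exact hp i⟩

/-- `P` is an uncountable set of elements of `H`, each attached to a branch of the tree of finite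
sequences in `W × Bool`, different elements to different branches. At a node `u` all branches
through `u` continue with the same label `c u`, so that the tree is at most binary, and any two
elements whose branches split at `u` are in the relation `R u (c u)`. -/
structure IsBranching {X W : Type*} (H : Set X) (R : List (W × Bool) → W → Set (X × X))
    (P : Set (X × (ℕ → W × Bool))) (c : List (W × Bool) → W) : Prop where
  uncountable : ¬ P.Countable
  mem : ∀ q ∈ P, q.1 ∈ H
  inj : ∀ q ∈ P, ∀ q' ∈ P, q.2 = q'.2 → q = q'
  label : ∀ q ∈ P, ∀ l, (q.2 l).1 = c (initSeg q.2 l)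
  rel : ∀ q ∈ P, ∀ q' ∈ P, ∀ l, initSeg q.2 l = initSeg q'.2 l → q.2 l ≠ q'.2 l →
    (q.1, q'.1) ∈ R (initSeg q.2 l) (c (initSeg q.2 l))

/-- The way in which the Open Colouring Axiom is used: it is applied to `H × (ℕ → W × Bool)`, and
a covering of this space by countably many homogeneous sets is excluded by a Baire category
argument in the second factor. -/
theorem exists_isBranching (hOCA : OCA) {W : Type} [Countable W] {H : Set (ℕ → ℕ)}
    {R : List (W × Bool) → W → Set ((ℕ → ℕ) × (ℕ → ℕ))} (hRo : ∀ u c, IsOpen (R u c))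
    (hRs : ∀ u c x y, (x, y) ∈ R u c → (y, x) ∈ R u c)
    (hH : ¬ SigmaCovered H fun F => ∃ u, ∀ c, ∀ x ∈ F, ∀ y ∈ F, (x, y) ∉ R u c) :
    ∃ P c, IsBranching H R P c := by
  let _ : TopologicalSpace W := ⊥
  have : DiscreteTopology W := ⟨rfl⟩
  let X := ↥H × (ℕ → W × Bool)
  let K : Set (X × X) := {z | ∃ l, initSeg z.1.2 l = initSeg z.2.2 l ∧
    (z.1.2 l).2 ≠ (z.2.2 l).2 ∧ (z.1.2 l).1 = (z.2.2 l).1 ∧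
    ((z.1.1 : ℕ → ℕ), (z.2.1 : ℕ → ℕ)) ∈ R (initSeg z.1.2 l) (z.1.2 l).1}
  have hKo : IsOpen K := by
    rw [isOpen_iff_mem_nhds]
    rintro z ⟨l, h1, h2, h3, h4⟩
    have e1 : ∀ᶠ w : X × X in 𝓝 z, initSeg w.1.2 (l + 1) = initSeg z.1.2 (l + 1) :=
      ((continuous_snd.comp continuous_fst).tendsto z).eventually
        (eventually_initSeg_eq z.1.2 (l + 1))
    have e2 : ∀ᶠ w : X × X in 𝓝 z, initSeg w.2.2 (l + 1) = initSeg z.2.2 (l + 1) :=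
      ((continuous_snd.comp continuous_snd).tendsto z).eventually
        (eventually_initSeg_eq z.2.2 (l + 1))
    have hc : Continuous fun w : X × X => ((w.1.1 : ℕ → ℕ), (w.2.1 : ℕ → ℕ)) :=
      (continuous_subtype_val.comp (continuous_fst.comp continuous_fst)).prodMk
        (continuous_subtype_val.comp (continuous_fst.comp continuous_snd))
    have e3 : ∀ᶠ w : X × X in 𝓝 z, ((w.1.1 : ℕ → ℕ), (w.2.1 : ℕ → ℕ)) ∈
        R (initSeg z.1.2 l) (z.1.2 l).1 := hc.continuousAt.eventually_mem ((hRo _ _).mem_nhds h4)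
    filter_upwards [e1, e2, e3] with w w1 w2 w3
    rw [initSeg_eq_iff] at w1 w2
    have w1' : initSeg w.1.2 l = initSeg z.1.2 l :=
      initSeg_eq_iff.2 fun i hi => w1 i (hi.trans l.lt_succ_self)
    have w2' : initSeg w.2.2 l = initSeg z.2.2 l :=
      initSeg_eq_iff.2 fun i hi => w2 i (hi.trans l.lt_succ_self)
    refine ⟨l, ?_, ?_, ?_, ?_⟩
    · rw [w1', w2', h1]
    · rwa [w1 l l.lt_succ_self, w2 l l.lt_succ_self]
    · rwa [w1 l l.lt_succ_self, w2 l l.lt_succ_self]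
    · rwa [w1', w1 l l.lt_succ_self]
  have hKs : ∀ x y, (x, y) ∈ K → (y, x) ∈ K := by
    rintro x y ⟨l, h1, h2, h3, h4⟩
    simp only at h1 h2 h3 h4
    refine ⟨l, h1.symm, h2.symm, h3.symm, ?_⟩
    simp only
    rw [← h1, ← h3]
    exact hRs _ _ _ _ h4
  have hKd : ∀ x, (x, x) ∉ K := by
    rintro x ⟨l, -, h2, -⟩
    exact h2 rfl
  rcases hOCA X K hKo hKs hKd with ⟨Q, hQc, hQ⟩ | ⟨F, hF, hFK⟩
  · have key : ∀ x ∈ Q, ∀ y ∈ Q, ∀ l, initSeg x.2 l = initSeg y.2 l → x.2 l ≠ y.2 l →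
        (x.2 l).1 = (y.2 l).1 ∧
          ((x.1 : ℕ → ℕ), (y.1 : ℕ → ℕ)) ∈ R (initSeg x.2 l) (x.2 l).1 := by
      intro x hx y hy l hl hne
      obtain ⟨k, h1, h2, h3, h4⟩ := hQ x hx y hy (fun h => hne (by rw [h]))
      simp only at h1 h2 h3 h4
      have hk : k = l := by
        rcases lt_trichotomy k l with h | h | h
        · exact absurd (congrArg Prod.snd (initSeg_eq_iff.1 hl k h)) h2
        · exact h
        · exact absurd (initSeg_eq_iff.1 h1 l h) hne
      subst hk
      exact ⟨h3, h4⟩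
    have hQn : Q.Nonempty := by
      by_contra h
      exact hQc (by simp [Set.not_nonempty_iff_eq_empty.1 h])
    have : Nonempty W := ⟨(hQn.some.2 0).1⟩
    have hlab : ∀ u : List (W × Bool), ∃ c : W, ∀ x ∈ Q, ∀ l, initSeg x.2 l = u →
        (x.2 l).1 = c := by
      intro u
      by_cases h : ∃ x ∈ Q, initSeg x.2 u.length = u
      · obtain ⟨x, hx, hxu⟩ := h
        refine ⟨(x.2 u.length).1, fun y hy l hl => ?_⟩
        obtain rfl : l = u.length := by rw [← hl, length_initSeg]
        by_cases hxy : y.2 u.length = x.2 u.length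
        · rw [hxy]
        · exact (key y hy x hx _ (hl.trans hxu.symm) hxy).1
      · refine ⟨Classical.arbitrary W, fun x hx l hl => absurd ⟨x, hx, ?_⟩ h⟩
        have : u.length = l := by rw [← hl, length_initSeg]
        rw [this, hl]
    choose c hc using hlab
    have hinj : Function.Injective fun x : X => ((x.1 : ℕ → ℕ), x.2) := fun x y h =>
      Prod.ext (Subtype.ext (congrArg Prod.fst h)) (congrArg (fun z => z.2) h)
    refine ⟨(fun x : X => ((x.1 : ℕ → ℕ), x.2)) '' Q, c, ?_, ?_, ?_, ?_, ?_⟩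
    · exact fun h => hQc (Set.countable_of_injective_of_countable_image hinj.injOn h)
    · rintro _ ⟨x, -, rfl⟩
      exact x.1.2
    · rintro _ ⟨x, hx, rfl⟩ _ ⟨y, hy, rfl⟩ h
      by_contra hne
      obtain ⟨l, -, h2, -⟩ := hQ x hx y hy (fun h => hne (by rw [h]))
      exact h2 (by simp only at h ⊢; rw [h])
    · rintro _ ⟨x, hx, rfl⟩ l
      exact hc _ x hx l rfl
    · rintro _ ⟨x, hx, rfl⟩ _ ⟨y, hy, rfl⟩ l hl hne
      have := (key x hx y hy l hl hne).2
      rwa [hc _ x hx l rfl] at this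
  · -- If all pieces `F n` avoid `K`, then every `x ∈ H` belongs to one of the countably many sets
    -- `G (n, u)` of those `x` for which the section of `F n` at `x` is dense above the node `u`.
    exfalso
    let G : ℕ × List (W × Bool) → Set (ℕ → ℕ) := fun i =>
      {x | ∃ hx : x ∈ H, ∀ v : W × Bool, ∃ p : ℕ → W × Bool,
        initSeg p i.2.length = i.2 ∧ p i.2.length = v ∧ ((⟨x, hx⟩, p) : X) ∈ F i.1}
    refine hH (sigmaCovered_of_forall_exists G (fun x hx => ?_) ?_)
    · by_cases hW : Nonempty (ℕ → W × Bool)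
      · let f : ℕ → Set (ℕ → W × Bool) := fun n => closure {p | ((⟨x, hx⟩, p) : X) ∈ F n}
        have hf : ⋃ n, f n = Set.univ := by
          refine Set.eq_univ_of_forall fun p => ?_
          have : ((⟨x, hx⟩, p) : X) ∈ ⋃ n, F n := by rw [hF]; trivial
          obtain ⟨n, hn⟩ := Set.mem_iUnion.1 this
          exact Set.mem_iUnion.2 ⟨n, subset_closure hn⟩
        obtain ⟨n, p, hp⟩ := nonempty_interior_of_iUnion_of_closed
          (fun n => isClosed_closure (s := {p | ((⟨x, hx⟩, p) : X) ∈ F n})) hf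
        obtain ⟨l, hl⟩ := exists_initSeg_subset_of_mem_nhds (mem_interior_iff_mem_nhds.1 hp)
        refine ⟨(n, initSeg p l), hx, fun v => ?_⟩
        have hmem : Function.update p l v ∈ f n := hl _ (initSeg_eq_iff.2 fun i hi => by
          rw [Function.update_of_ne hi.ne])
        obtain ⟨r, hr1, hr2⟩ := (mem_closure_iff_nhds.1 hmem) _
          (eventually_initSeg_eq (Function.update p l v) (l + 1))
        have hr1 : initSeg r (l + 1) = initSeg (Function.update p l v) (l + 1) := hr1
        rw [initSeg_eq_iff] at hr1
        refine ⟨r, ?_, ?_, hr2⟩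
        · simp only [length_initSeg]
          refine initSeg_eq_iff.2 fun i hi => ?_
          rw [hr1 i (hi.trans l.lt_succ_self), Function.update_of_ne hi.ne]
        · simp only [length_initSeg]
          rw [hr1 l l.lt_succ_self, Function.update_self]
      · refine ⟨(0, []), hx, fun v => absurd ⟨fun _ => v⟩ hW⟩
    · rintro ⟨n, u⟩
      refine ⟨u, fun c x hx y hy hxy => ?_⟩
      obtain ⟨hxH, hx⟩ := hx
      obtain ⟨hyH, hy⟩ := hy
      obtain ⟨p, hp1, hp2, hp3⟩ := hx (c, true)
      obtain ⟨q, hq1, hq2, hq3⟩ := hy (c, false)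
      simp only at hp1 hp2 hp3 hq1 hq2 hq3
      refine hFK n _ hp3 _ hq3 (fun h => ?_) ⟨u.length, ?_, ?_, ?_, ?_⟩
      · have h2 : p = q := congrArg Prod.snd h
        rw [h2, hq2] at hp2
        simp at hp2
      · exact hp1.trans hq1.symm
      · simp only [hp2, hq2]; decide
      · simp only [hp2, hq2]
      · simp only [hp2, hp1]; exact hxy

/-! ### Codes of partial maps of product form -/

section

variable {M N : ℕ → Type*} [∀ n, MetricSpace (N n)]

/-- A sequence `e` codes a sequence of maps `M n → N n` defined for those `n` for which
`dec n (e n)` is not `none`. The code `e` *lifts* `Φ` if these maps approximate `Φ` asymptotically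
on the set of all such `n`. -/
def Lifts (dec : ∀ n, ℕ → Option (M n → N n)) (Φ : (∀ n, M n) → ∀ n, N n) (e : ℕ → ℕ) : Prop :=
  ∀ a : ∀ n, M n, ∀ δ > 0, ∀ᶠ n in atTop, ∀ h, dec n (e n) = some h →
    dist (Φ a n) (h (a n)) ≤ δ

/-- At the coordinate `m` the codes `e` and `e'` are both defined, and their values at the point
numbered `i` are more than `θ` apart. -/
def Differ (dec : ∀ n, ℕ → Option (M n → N n)) (pt : ∀ n, ℕ → M n) (θ : ℝ) (m i : ℕ)
    (e e' : ℕ → ℕ) : Prop :=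
  ∃ h h', dec m (e m) = some h ∧ dec m (e' m) = some h' ∧ θ < dist (h (pt m i)) (h' (pt m i))

variable {dec : ∀ n, ℕ → Option (M n → N n)} {pt : ∀ n, ℕ → M n}
  {Φ : (∀ n, M n) → ∀ n, N n}

theorem Differ.symm {θ : ℝ} {m i : ℕ} {e e' : ℕ → ℕ} (h : Differ dec pt θ m i e e') :
    Differ dec pt θ m i e' e := by
  obtain ⟨f, g, hf, hg, hd⟩ := h
  exact ⟨g, f, hg, hf, by rwa [dist_comm]⟩

theorem Differ.mono {θ θ' : ℝ} {m i : ℕ} {e e' : ℕ → ℕ} (h : Differ dec pt θ m i e e')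
    (hθ : θ' ≤ θ) : Differ dec pt θ' m i e e' := by
  obtain ⟨f, g, hf, hg, hd⟩ := h
  exact ⟨f, g, hf, hg, hθ.trans_lt hd⟩

theorem Differ.ne {θ : ℝ} (hθ : 0 ≤ θ) {m i : ℕ} {e e' : ℕ → ℕ}
    (h : Differ dec pt θ m i e e') : e m ≠ e' m := by
  obtain ⟨f, g, hf, hg, hd⟩ := h
  intro he
  rw [he, hg] at hf
  obtain rfl := Option.some.inj hf
  rw [dist_self] at hd
  exact absurd hd hθ.not_gt

theorem Differ.or {θ : ℝ} {m i : ℕ} {e e' r : ℕ → ℕ}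
    (h : Differ dec pt θ m i e e') (hr : (dec m (r m)).isSome) :
    Differ dec pt (θ / 2) m i e r ∨ Differ dec pt (θ / 2) m i e' r := by
  obtain ⟨f, f', hf, hf', hd⟩ := h
  obtain ⟨g, hr⟩ := Option.isSome_iff_exists.1 hr
  by_contra! hcon
  have h1 : dist (f (pt m i)) (g (pt m i)) ≤ θ / 2 :=
    not_lt.1 fun h => hcon.1 ⟨f, g, hf, hr, h⟩
  have h2 : dist (f' (pt m i)) (g (pt m i)) ≤ θ / 2 :=
    not_lt.1 fun h => hcon.2 ⟨f', g, hf', hr, h⟩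
  linarith [dist_triangle_right (f (pt m i)) (f' (pt m i)) (g (pt m i))]

theorem isOpen_differ (θ : ℝ) (m i : ℕ) :
    IsOpen {z : (ℕ → ℕ) × (ℕ → ℕ) | Differ dec pt θ m i z.1 z.2} := by
  have hc : Continuous fun z : (ℕ → ℕ) × (ℕ → ℕ) => (z.1 m, z.2 m) := by fun_prop
  exact (isOpen_discrete {w : ℕ × ℕ | ∃ h h', dec m w.1 = some h ∧ dec m w.2 = some h' ∧
    θ < dist (h (pt m i)) (h' (pt m i))}).preimage hc

theorem isOpen_forall_mem_finset {X ι : Type*} [TopologicalSpace X] (s : Finset ι)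
    {p : ι → X → Prop} (hp : ∀ i, IsOpen {x | p i x}) : IsOpen {x | ∀ i ∈ s, p i x} := by
  have h : {x | ∀ i ∈ s, p i x} = ⋂ i ∈ s, {x | p i x} := by ext; simp
  rw [h]
  exact isOpen_biInter_finset fun i _ => hp i

/-- The node `u` is one at which two branches of elements of `P` split. -/
def IsSplitNode {X V : Type*} (P : Set (X × (ℕ → V))) (u : List V) : Prop :=
  ∃ q ∈ P, ∃ q' ∈ P, ∃ l, initSeg q.2 l = u ∧ initSeg q'.2 l = u ∧ q.2 l ≠ q'.2 l

/-- If the codes splitting at `u` differ at the coordinate `μ u` and the point numbered `ξ u`, with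
distinct coordinates for distinct nodes, then there is a single sequence `a` that passes through all
these points. As all the codes agree with `Φ a` from some coordinate on, there can be only countably
many of them. -/
theorem countable_of_differ {V : Type*} [Countable V] {P : Set ((ℕ → ℕ) × (ℕ → V))}
    (hP : ∀ q ∈ P, Lifts dec Φ q.1) (hinj : ∀ q ∈ P, ∀ q' ∈ P, q.2 = q'.2 → q = q')
    {θ : ℝ} (hθ : 0 < θ) (μ ξ : List V → ℕ)
    (hd : ∀ q ∈ P, ∀ q' ∈ P, ∀ l, initSeg q.2 l = initSeg q'.2 l → q.2 l ≠ q'.2 l →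
      Differ dec pt θ (μ (initSeg q.2 l)) (ξ (initSeg q.2 l)) q.1 q'.1)
    (hμ : Set.InjOn μ {u | IsSplitNode P u}) : P.Countable := by
  classical
  let a : ∀ n, M n := fun n =>
    if h : ∃ u, IsSplitNode P u ∧ μ u = n then pt n (ξ h.choose) else pt n 0
  have ha : ∀ u, IsSplitNode P u → a (μ u) = pt (μ u) (ξ u) := by
    intro u hu
    have h : ∃ v, IsSplitNode P v ∧ μ v = μ u := ⟨u, hu, rfl⟩
    have h1 : h.choose = u := hμ h.choose_spec.1 hu h.choose_spec.2
    simp only [a, dif_pos h, h1]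
  have hK : ∀ q ∈ P, ∃ K, ∀ n ≥ K, ∀ h, dec n (q.1 n) = some h →
      dist (Φ a n) (h (a n)) ≤ θ / 2 := fun q hq =>
    eventually_atTop.1 (hP q hq a (θ / 2) (half_pos hθ))
  choose! K hK using hK
  have hL : ∀ k, ∃ L, ∀ u, IsSplitNode P u → μ u < k → u.length < L := by
    intro k
    have hfin : {u | IsSplitNode P u ∧ μ u < k}.Finite := by
      refine Set.Finite.of_finite_image ((Set.finite_lt_nat k).subset ?_)
        (hμ.mono fun u hu => hu.1)
      rintro _ ⟨u, hu, rfl⟩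
      exact hu.2
    obtain ⟨L, hL⟩ := (hfin.image List.length).bddAbove
    exact ⟨L + 1, fun u hu hk => Nat.lt_succ_of_le (hL ⟨u, ⟨hu, hk⟩, rfl⟩)⟩
  choose L hL using hL
  refine Set.MapsTo.countable_of_injOn (t := Set.univ)
    (f := fun q => (K q, initSeg q.2 (L (K q)))) (fun _ _ => trivial) ?_ Set.countable_univ
  intro q hq q' hq' heq
  by_contra hne
  obtain ⟨h1, h2⟩ := Prod.mk.inj heq
  rw [← h1] at h2
  have hex : ∃ l, q.2 l ≠ q'.2 l := by
    by_contra! h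
    exact hne (hinj q hq q' hq' (funext h))
  let l := Nat.find hex
  have hl : q.2 l ≠ q'.2 l := Nat.find_spec hex
  have hbelow : initSeg q.2 l = initSeg q'.2 l :=
    initSeg_eq_iff.2 fun i hi => not_not.1 (Nat.find_min hex hi)
  have hLl : L (K q) ≤ l := by
    by_contra! h
    exact hl (initSeg_eq_iff.1 h2 l h)
  have hs : IsSplitNode P (initSeg q.2 l) := ⟨q, hq, q', hq', l, rfl, hbelow.symm, hl⟩
  have hKμ : K q ≤ μ (initSeg q.2 l) := by
    by_contra! h
    have := hL _ _ hs h
    rw [length_initSeg] at this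
    omega
  obtain ⟨f, f', hf, hf', hlt⟩ := hd q hq q' hq' l hbelow hl
  have e1 := hK q hq _ hKμ f hf
  have e2 := hK q' hq' _ (h1 ▸ hKμ) f' hf'
  rw [ha _ hs] at e1 e2
  linarith [dist_triangle_left (f (pt _ (ξ (initSeg q.2 l)))) (f' (pt _ (ξ (initSeg q.2 l))))
    (Φ a (μ (initSeg q.2 l)))]

theorem IsBranching.initSeg_eq_of_map_snd {X W : Type*} {H : Set X}
    {R : List (W × Bool) → W → Set (X × X)} {P : Set (X × (ℕ → W × Bool))}
    {c : List (W × Bool) → W} (hB : IsBranching H R P c) {q q' : X × (ℕ → W × Bool)}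
    (hq : q ∈ P) (hq' : q' ∈ P) {l l' : ℕ}
    (h : (initSeg q.2 l).map Prod.snd = (initSeg q'.2 l').map Prod.snd) :
    initSeg q.2 l = initSeg q'.2 l' := by
  obtain rfl : l = l' := by simpa using congrArg List.length h
  simp only [initSeg, List.map_map, List.map_inj_left, List.mem_range, Function.comp] at h
  refine initSeg_eq_iff.2 fun i => ?_
  induction i using Nat.strong_induction_on with
  | _ i ih =>
    intro hi
    refine Prod.ext ?_ (h i hi)
    rw [hB.label q hq, hB.label q' hq']
    exact congrArg c (initSeg_eq_iff.2 fun k hk => ih k hk (hk.trans hi))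

/-! ### Bounding the number of differences -/

/-- Otherwise there would be a branching set of codes with so many differences at each splitting
node that, by Hall's marriage theorem, distinct coordinates can be selected for distinct nodes. -/
theorem sigmaCovered_boundedly_many_differ (hOCA : OCA) {H : Set (ℕ → ℕ)}
    (hH : ∀ e ∈ H, Lifts dec Φ e) {θ : ℝ} (hθ : 0 < θ) :
    SigmaCovered H fun F => ∃ k, ∀ c : Finset (ℕ × ℕ), k ≤ (c.image Prod.fst).card →
      ∀ x ∈ F, ∀ y ∈ F, ¬ ∀ z ∈ c, Differ dec pt θ z.1 z.2 x y := by
  classical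
  by_contra hcon
  let B : ℕ → ℕ := fun l => {s : List Bool | s.length ≤ l}.ncard
  let R : List (Finset (ℕ × ℕ) × Bool) → Finset (ℕ × ℕ) → Set ((ℕ → ℕ) × (ℕ → ℕ)) := fun u c =>
    {z | B u.length ≤ (c.image Prod.fst).card ∧ ∀ w ∈ c, Differ dec pt θ w.1 w.2 z.1 z.2}
  have hRo : ∀ u c, IsOpen (R u c) := fun u c =>
    isOpen_const.inter
      (isOpen_forall_mem_finset c fun w => isOpen_differ θ w.1 w.2)
  obtain ⟨P, c, hB⟩ := exists_isBranching hOCA (H := H) hRo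
    (fun u c x y h => ⟨h.1, fun w hw => (h.2 w hw).symm⟩) (fun h => hcon (h.bind fun F hF => by
      obtain ⟨u, hu⟩ := hF
      exact ⟨{F}, Set.countable_singleton F, by simp, by
        rintro _ rfl
        exact ⟨B u.length, fun c hc x hx y hy h => hu c x hx y hy ⟨hc, h⟩⟩⟩))
  have hHall : ∀ s : Finset {u // IsSplitNode P u},
      s.card ≤ (s.biUnion fun u => (c u.1).image Prod.fst).card := by
    intro s
    rcases s.eq_empty_or_nonempty with rfl | hs
    · simp
    obtain ⟨u, hus, hu⟩ := s.exists_max_image (fun u => u.1.length) hs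
    have h1 : s.card ≤ B u.1.length := by
      rw [← Set.ncard_coe_finset]
      refine Set.ncard_le_ncard_of_injOn (fun v => v.1.map Prod.snd) (fun v hv => ?_) ?_
        (List.finite_length_le Bool u.1.length)
      · simpa using hu v hv
      · rintro ⟨_, q, hq, _, _, l, rfl, _⟩ _ ⟨_, q', hq', _, _, l', rfl, _⟩ _ h
        exact Subtype.ext (hB.initSeg_eq_of_map_snd hq hq' h)
    have h2 : B u.1.length ≤ ((c u.1).image Prod.fst).card := by
      obtain ⟨_, q, hq, q', hq', l, rfl, h, hne⟩ := u
      exact (hB.rel q hq q' hq' l h.symm hne).1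
    exact h1.trans (h2.trans (Finset.card_le_card
      (Finset.subset_biUnion_of_mem (fun u => (c u.1).image Prod.fst) hus)))
  obtain ⟨f, hf, hfc⟩ := (Finset.all_card_le_biUnion_card_iff_exists_injective _).1 hHall
  have hex : ∀ u, ∃ z : ℕ × ℕ, ∀ h : IsSplitNode P u, z ∈ c u ∧ z.1 = f ⟨u, h⟩ := by
    intro u
    by_cases h : IsSplitNode P u
    · obtain ⟨z, hz, hzf⟩ := Finset.mem_image.1 (hfc ⟨u, h⟩)
      exact ⟨z, fun _ => ⟨hz, hzf⟩⟩
    · exact ⟨(0, 0), fun h' => absurd h' h⟩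
  choose z hz using hex
  refine hB.uncountable (countable_of_differ (dec := dec) (pt := pt) (Φ := Φ)
    (fun q hq => hH _ (hB.mem q hq)) hB.inj hθ (fun u => (z u).1) (fun u => (z u).2) ?_ ?_)
  · intro q hq q' hq' l h hne
    exact (hB.rel q hq q' hq' l h hne).2 _ (hz _ ⟨q, hq, q', hq', l, rfl, h.symm, hne⟩).1
  · intro u hu v hv h
    have h : (z u).1 = (z v).1 := h
    rw [(hz u hu).2, (hz v hv).2] at h
    exact congrArg Subtype.val (hf h)

/-! ### Removing the differences -/

/-- `c = (D, m, i)` testifies that `e` and `e'` differ by more than `θ / 2` at all coordinates in the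
finite set `D`, and by more than `θ` at the coordinate `m ∈ D` and the point numbered `i`. -/
def Testifies (dec : ∀ n, ℕ → Option (M n → N n)) (pt : ∀ n, ℕ → M n) (θ : ℝ)
    (c : Finset ℕ × ℕ × ℕ) (e e' : ℕ → ℕ) : Prop :=
  c.2.1 ∈ c.1 ∧ (∀ n ∈ c.1, ∃ i, Differ dec pt (θ / 2) n i e e') ∧
    Differ dec pt θ c.2.1 c.2.2 e e'

/-- No two elements of `F` differ by more than `θ / 2` at `j` coordinates, and by more than `θ` at
one of these. -/
def DifferFree (dec : ∀ n, ℕ → Option (M n → N n)) (pt : ∀ n, ℕ → M n) (θ : ℝ) (j : ℕ)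
    (F : Set (ℕ → ℕ)) : Prop :=
  ∀ c : Finset ℕ × ℕ × ℕ, c.1.card = j → ∀ x ∈ F, ∀ y ∈ F, ¬ Testifies dec pt θ c x y

/-- Otherwise there would be a branching set of codes in which any two elements differ by more than
`θ / 2` at exactly `j` coordinates, which are determined by their splitting node `u` and include a
coordinate `μ u` with a difference of more than `θ`. By the triangle inequality and since the
coordinates increase along branches, `μ` is injective. -/
theorem DifferFree.sigmaCovered (hOCA : OCA) {F : Set (ℕ → ℕ)} (hF : ∀ e ∈ F, Lifts dec Φ e)
    {θ : ℝ} (hθ : 0 < θ) {j : ℕ} (hFj : DifferFree dec pt θ (j + 1) F) :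
    SigmaCovered F (DifferFree dec pt θ j) := by
  classical
  by_contra hcon
  let R : List ((Finset ℕ × ℕ × ℕ) × Bool) → (Finset ℕ × ℕ × ℕ) → Set ((ℕ → ℕ) × (ℕ → ℕ)) :=
    fun u c => {z | (c.1.card = j ∧ ∀ v ∈ u, ∀ n ∈ v.1.1, ∀ m ∈ c.1, n < m) ∧
      Testifies dec pt θ c z.1 z.2}
  have hRo : ∀ u c, IsOpen (R u c) := by
    refine fun u c => isOpen_const.inter (isOpen_const.inter (IsOpen.inter ?_ ?_))
    · refine isOpen_forall_mem_finset c.1 fun n => ?_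
      have h : {z : (ℕ → ℕ) × (ℕ → ℕ) | ∃ i, Differ dec pt (θ / 2) n i z.1 z.2} =
          ⋃ i, {z | Differ dec pt (θ / 2) n i z.1 z.2} := by ext; simp
      rw [h]
      exact isOpen_iUnion fun i => isOpen_differ (θ / 2) n i
    · exact isOpen_differ θ _ _
  obtain ⟨P, c, hB⟩ := exists_isBranching hOCA (H := F) hRo
    (fun u c x y h => ⟨h.1, h.2.1, fun n hn => (h.2.2.1 n hn).imp fun i hi => hi.symm,
      h.2.2.2.symm⟩) (fun h => hcon (h.bind fun G hG => by
      obtain ⟨u, hu⟩ := hG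
      obtain ⟨k, hk⟩ : ∃ k, ∀ v ∈ u, ∀ n ∈ v.1.1, n < k := by
        have hfin : {n | ∃ v ∈ u, n ∈ v.1.1}.Finite :=
          (Set.Finite.biUnion (u.finite_toSet) fun v _ => v.1.1.finite_toSet).subset (by
            rintro n ⟨v, hv, hn⟩
            exact Set.mem_biUnion hv hn)
        obtain ⟨k, hk⟩ := hfin.bddAbove
        exact ⟨k + 1, fun v hv n hn => Nat.lt_succ_of_le (hk ⟨v, hv, hn⟩)⟩
      -- Codes with the same first `k` values can differ only at coordinates from `k` on.
      refine sigmaCovered_of_forall_exists (fun s : List ℕ => {e ∈ G | initSeg e k = s})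
        (fun x hx => ⟨_, hx, rfl⟩) ?_
      rintro _ d hd x ⟨hx, rfl⟩ y ⟨hy, hyx⟩ hT
      refine hu d x hx y hy ⟨⟨hd, fun v hv n hn m hm => (hk v hv n hn).trans_le ?_⟩, hT⟩
      by_contra! hmk
      obtain ⟨i, hi⟩ := hT.2.1 m hm
      exact hi.ne (half_pos hθ).le (initSeg_eq_iff.1 hyx m hmk).symm))
  refine hB.uncountable (countable_of_differ (dec := dec) (pt := pt) (Φ := Φ)
    (fun q hq => hF _ (hB.mem q hq)) hB.inj hθ (fun u => (c u).2.1) (fun u => (c u).2.2) ?_ ?_)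
  · exact fun q hq q' hq' l h hne => (hB.rel q hq q' hq' l h hne).2.2.2
  · -- A coordinate is strictly larger than the coordinates attached to the nodes below it.
    have hlt : ∀ q ∈ P, ∀ l k, k < l → IsSplitNode P (initSeg q.2 l) →
        ∀ n ∈ (c (initSeg q.2 k)).1, n < (c (initSeg q.2 l)).2.1 := by
      intro q hq l k hkl hs n hn
      obtain ⟨r, hr, r', hr', l', h1, h2, hne⟩ := hs
      have hrel := hB.rel r hr r' hr' l' (h1.trans h2.symm) hne
      rw [h1] at hrel
      refine hrel.1.2 _ (mem_initSeg hkl) n ?_ _ hrel.2.1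
      rwa [hB.label q hq k]
    rintro u ⟨q, hq, q', hq', l, rfl, hu', hne⟩ v ⟨r, hr, r', hr', l', rfl, hv', hne'⟩ hm
    have hm : (c (initSeg q.2 l)).2.1 = (c (initSeg r.2 l')).2.1 := hm
    have hsu : IsSplitNode P (initSeg q.2 l) := ⟨q, hq, q', hq', l, rfl, hu', hne⟩
    have hsv : IsSplitNode P (initSeg r.2 l') := ⟨r, hr, r', hr', l', rfl, hv', hne'⟩
    have hTu := (hB.rel q hq q' hq' l hu'.symm hne).2
    have hTv := (hB.rel r hr r' hr' l' hv'.symm hne').2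
    by_cases hex : ∃ k, k < l ∧ k < l' ∧ q.2 k ≠ r.2 k
    · -- The two nodes are incomparable; let `k` be the level at which they split.
      exfalso
      let k := Nat.find hex
      obtain ⟨hkl, hkl', hk⟩ : k < l ∧ k < l' ∧ q.2 k ≠ r.2 k := Nat.find_spec hex
      have hbelow : initSeg q.2 k = initSeg r.2 k := initSeg_eq_iff.2 fun i hi => by
        have := Nat.find_min hex hi
        by_contra h
        exact this ⟨hi.trans hkl, hi.trans hkl', h⟩
      have hbelow' : initSeg q'.2 k = initSeg r.2 k := by
        rw [← hbelow]
        exact initSeg_eq_iff.2 fun i hi => initSeg_eq_iff.1 hu' i (hi.trans hkl)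
      have hk' : q'.2 k ≠ r.2 k := by
        rwa [initSeg_eq_iff.1 hu' k hkl]
      have hnot : (c (initSeg q.2 l)).2.1 ∉ (c (initSeg r.2 k)).1 := by
        rw [← hbelow]
        exact fun h => (hlt q hq l k hkl hsu _ h).false
      have hg : (dec (c (initSeg r.2 l')).2.1 (r.1 (c (initSeg r.2 l')).2.1)).isSome := by
        obtain ⟨g, _, hg, -⟩ := hTv.2.2
        exact Option.isSome_iff_exists.2 ⟨g, hg⟩
      rw [← hm] at hg
      have main : ∀ p ∈ P, initSeg p.2 k = initSeg r.2 k → p.2 k ≠ r.2 k →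
          ¬ Differ dec pt (θ / 2) (c (initSeg q.2 l)).2.1 (c (initSeg q.2 l)).2.2 p.1 r.1 := by
        intro p hp hpr hne hd
        have hrel := hB.rel p hp r hr k hpr hne
        rw [hpr] at hrel
        refine hFj (insert (c (initSeg q.2 l)).2.1 (c (initSeg r.2 k)).1, (c (initSeg r.2 k)).2)
          ?_ p.1 (hB.mem p hp) r.1 (hB.mem r hr) ⟨?_, ?_, hrel.2.2.2⟩
        · rw [Finset.card_insert_of_notMem hnot, hrel.1.1]
        · exact Finset.mem_insert_of_mem hrel.2.1
        · intro n hn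
          rcases Finset.mem_insert.1 hn with rfl | hn
          · exact ⟨_, hd⟩
          · exact hrel.2.2.1 n hn
      rcases hTu.2.2.or hg with h | h
      · exact main q hq hbelow hk h
      · exact main q' hq' hbelow' hk' h
    · push Not at hex
      rcases lt_trichotomy l l' with h | rfl | h
      · exfalso
        have e : initSeg q.2 l = initSeg r.2 l := initSeg_eq_iff.2 fun i hi =>
          hex i hi (hi.trans h)
        have := hlt r hr l' l h hsv _ (e ▸ hTu.1)
        rw [← hm, ← e] at this
        exact this.false
      · exact initSeg_eq_iff.2 fun i hi => hex i hi hi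
      · exfalso
        have e : initSeg q.2 l' = initSeg r.2 l' := initSeg_eq_iff.2 fun i hi =>
          hex i (hi.trans h) hi
        have := hlt q hq l l' h hsu _ (e.symm ▸ hTv.1)
        rw [hm, e] at this
        exact this.false

theorem SigmaCovered.restrict {X : Type*} {H : Set X} {p : Set X → Prop} (h : SigmaCovered H p) :
    SigmaCovered H fun F => F ⊆ H ∧ ∃ G, F ⊆ G ∧ p G := by
  obtain ⟨𝒞, hc, hH, hp⟩ := h
  refine ⟨(fun F => F ∩ H) '' 𝒞, hc.image _, fun x hx => ?_, ?_⟩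
  · obtain ⟨F, hF, hxF⟩ := hH hx
    exact ⟨F ∩ H, ⟨F, hF, rfl⟩, hxF, hx⟩
  · rintro _ ⟨F, hF, rfl⟩
    exact ⟨Set.inter_subset_right, F, Set.inter_subset_left, hp F hF⟩

theorem DifferFree.mono {θ : ℝ} {j : ℕ} {F G : Set (ℕ → ℕ)} (hG : DifferFree dec pt θ j G)
    (h : F ⊆ G) : DifferFree dec pt θ j F :=
  fun c hc x hx y hy => hG c hc x (h hx) y (h hy)

theorem DifferFree.sigmaCovered_one (hOCA : OCA) {F : Set (ℕ → ℕ)} (hF : ∀ e ∈ F, Lifts dec Φ e)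
    {θ : ℝ} (hθ : 0 < θ) {j : ℕ} (hFj : DifferFree dec pt θ (j + 1) F) :
    SigmaCovered F (DifferFree dec pt θ 1) := by
  induction j generalizing F with
  | zero => exact ⟨{F}, Set.countable_singleton F, by simp, by rintro _ rfl; exact hFj⟩
  | succ j ih =>
    refine (hFj.sigmaCovered hOCA hF hθ).restrict.bind ?_
    rintro G ⟨hGF, G', hGG', hG'⟩
    exact ih (fun e he => hF e (hGF he)) (hG'.mono hGG')

theorem sigmaCovered_not_differ (hOCA : OCA) {H : Set (ℕ → ℕ)} (hH : ∀ e ∈ H, Lifts dec Φ e)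
    {θ : ℝ} (hθ : 0 < θ) :
    SigmaCovered H fun F => ∀ x ∈ F, ∀ y ∈ F, ∀ m i, ¬ Differ dec pt θ m i x y := by
  classical
  refine (sigmaCovered_boundedly_many_differ (pt := pt) hOCA hH (half_pos hθ)).restrict.bind ?_
  rintro F ⟨hFH, G, hFG, k, hk⟩
  have hfree : DifferFree dec pt θ (k + 1) F := by
    rintro ⟨D, m, i⟩ hD x hx y hy ⟨-, hT, -⟩
    simp only at hD hT
    choose! f hf using hT
    refine hk (D.image fun n => (n, f n)) ?_ x (hFG hx) y (hFG hy) ?_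
    · have : (D.image fun n => (n, f n)).image Prod.fst = D := by
        simp [Finset.image_image, Function.comp_def]
      rw [this]
      omega
    · intro z hz
      obtain ⟨n, hn, rfl⟩ := Finset.mem_image.1 hz
      exact hf n hn
  refine (hfree.sigmaCovered_one hOCA (fun e he => hH e (hFH he)) hθ).bind fun G hG => ?_
  refine ⟨{G}, Set.countable_singleton G, by simp, ?_⟩
  rintro _ rfl x hx y hy m i hd
  refine hG ({m}, m, i) (Finset.card_singleton m) x hx y hy ⟨Finset.mem_singleton_self m, ?_, hd⟩
  intro n hn
  obtain rfl := Finset.mem_singleton.1 hn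
  exact ⟨i, hd.mono (half_le_self hθ.le)⟩

end

/-! ### Almost disjoint families -/

/-- The sets of finite initial segments of the branches of a binary tree form an almost disjoint
family of size continuum. Here the members of the family moreover follow the branches in all the
sets `B k` at once. -/
theorem exists_almostDisjoint_inter_infinite {B : ℕ → Set ℕ} (hB : ∀ k, (B k).Infinite) :
    ∃ 𝒜 : Set (Set ℕ), ¬ 𝒜.Countable ∧ AlmostDisjoint 𝒜 ∧
      ∀ A ∈ 𝒜, A ⊆ ⋃ k, B k ∧ ∀ k, (A ∩ B k).Infinite := by
  let f : ℕ → ℕ := fun i => ((Encodable.decode i : Option (ℕ × List Bool)).elim 0 Prod.fst)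
  obtain ⟨b, hb, hbB⟩ := extraction_forall_of_frequently (P := fun i n => n ∈ B (f i))
    fun i => Nat.frequently_atTop_iff_infinite.2 (hB (f i))
  let β : ℕ → List Bool → ℕ := fun k s => b (Encodable.encode (k, s))
  have hβB : ∀ k s, β k s ∈ B k := fun k s => by
    have := hbB (Encodable.encode (k, s))
    simpa [f, β] using this
  have hβ : ∀ k s k' s', β k s = β k' s' → k = k' ∧ s = s' := fun k s k' s' h => by
    simpa [Encodable.encode_inj] using hb.injective h
  let C : (ℕ → Bool) → Set ℕ := fun x => {n | ∃ k j, k ≤ j ∧ β k (initSeg x j) = n}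
  have hCB : ∀ x k, (C x ∩ B k).Infinite := fun x k => by
    refine Set.infinite_of_injective_forall_mem (f := fun i : ℕ => β k (initSeg x (k + i)))
      (fun i i' h => ?_) fun i => ⟨⟨k, k + i, Nat.le_add_right k i, rfl⟩, hβB _ _⟩
    have := congrArg List.length (hβ _ _ _ _ h).2
    simpa using this
  have hCC : ∀ x y, x ≠ y → (C x ∩ C y).Finite := fun x y hxy => by
    obtain ⟨d, hd⟩ := Function.ne_iff.1 hxy
    refine (((Set.finite_le_nat d).prod (Set.finite_le_nat d)).image
      fun z : ℕ × ℕ => β z.1 (initSeg x z.2)).subset ?_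
    rintro _ ⟨⟨k, j, hkj, rfl⟩, k', j', hkj', h⟩
    obtain ⟨rfl, hseg⟩ := hβ _ _ _ _ h
    obtain rfl : j' = j := by simpa using congrArg List.length hseg
    have hj : j' ≤ d := by
      by_contra! hlt
      exact hd (initSeg_eq_iff.1 hseg d hlt).symm
    exact ⟨(k', j'), ⟨hkj.trans hj, hj⟩, rfl⟩
  have hCinf : ∀ x, (C x).Infinite := fun x => (hCB x 0).mono Set.inter_subset_left
  have hCinj : Function.Injective C := fun x y h => by
    by_contra hne
    have := hCC x y hne
    rw [h, Set.inter_self] at this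
    exact hCinf y this
  refine ⟨Set.range C, fun h => ?_, ⟨?_, ?_⟩, ?_⟩
  · rw [← Set.image_univ] at h
    have h1 := Set.countable_of_injective_of_countable_image hCinj.injOn h
    have h2 := Set.countable_univ_iff.1 h1
    obtain ⟨u, hu⟩ := exists_surjective_nat (ℕ → Bool)
    obtain ⟨n, hn⟩ := hu fun n => !(u n n)
    simpa using congrFun hn n
  · rintro _ ⟨x, rfl⟩
    exact hCinf x
  · rintro _ ⟨x, rfl⟩ _ ⟨y, rfl⟩ h
    exact hCC x y fun hxy => h (by rw [hxy])
  · rintro _ ⟨x, rfl⟩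
    refine ⟨?_, hCB x⟩
    rintro _ ⟨k, j, -, rfl⟩
    exact Set.mem_iUnion.2 ⟨k, hβB _ _⟩

/-! ### Gluing the codes to a lifting of product form -/

section

variable {M N : ℕ → Type*} [∀ n, MetricSpace (N n)]
  {dec : ∀ n, ℕ → Option (M n → N n)} {pt : ∀ n, ℕ → M n} {Φ : (∀ n, M n) → ∀ n, N n}

theorem Lifts.eventually_dist_le [∀ n, Nonempty (M n)] {e e' : ℕ → ℕ} (he : Lifts dec Φ e)
    (he' : Lifts dec Φ e') {δ : ℝ} (hδ : 0 < δ) :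
    ∀ᶠ n in atTop, ∀ h h', dec n (e n) = some h → dec n (e' n) = some h' →
      ∀ x, dist (h x) (h' x) ≤ δ := by
  classical
  let p : ∀ n, M n → Prop := fun n x => ∃ h h', dec n (e n) = some h ∧ dec n (e' n) = some h' ∧
    δ < dist (h x) (h' x)
  let a : ∀ n, M n := fun n => Classical.epsilon (p n)
  filter_upwards [he a (δ / 2) (half_pos hδ), he' a (δ / 2) (half_pos hδ)] with n h1 h2 h h' hh hh' x
  by_contra! hlt
  obtain ⟨f, f', hf, hf', hd⟩ : p n (a n) :=
    Classical.epsilon_spec (p := p n) ⟨x, h, h', hh, hh', hlt⟩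
  linarith [h1 f hf, h2 f' hf', dist_triangle_left (f (a n)) (f' (a n)) (Φ a n)]

/-- The form in which the hypothesis on almost disjoint families is used: given countably many
infinite sets, some code that lifts `Φ` has a domain contained in their union and meeting each of
them in an infinite set. -/
def MeetsInfinite (dec : ∀ n, ℕ → Option (M n → N n)) (Φ : (∀ n, M n) → ∀ n, N n) : Prop :=
  ∀ B : ℕ → Set ℕ, (∀ k, (B k).Infinite) → ∃ e, Lifts dec Φ e ∧
    (∀ n, (dec n (e n)).isSome → n ∈ ⋃ k, B k) ∧ ∀ k, {n ∈ B k | (dec n (e n)).isSome}.Infinite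

theorem MeetsInfinite.eventually (hmeet : MeetsInfinite dec Φ) {p : ℕ → Prop}
    (hp : ∀ e, Lifts dec Φ e → ∀ᶠ n in atTop, ∀ h, dec n (e n) = some h → p n) :
    ∀ᶠ n in atTop, p n := by
  by_contra hcon
  have hinf : {n | ¬ p n}.Infinite := Nat.frequently_atTop_iff_infinite.1 (not_eventually.1 hcon)
  obtain ⟨e, he, -, h2⟩ := hmeet (fun _ => {n | ¬ p n}) fun _ => hinf
  obtain ⟨n, ⟨hn, hs⟩, hpn⟩ :=
    ((Nat.frequently_atTop_iff_infinite.2 (h2 0)).and_eventually (hp e he)).exists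
  obtain ⟨h, hh⟩ := Option.isSome_iff_exists.1 hs
  exact hn (hpn h hh)

/-- A covering of the set of all codes by countably many sets without differences of more than `θ`
provides countably many candidates for a uniform approximation. If each candidate failed for some
code on some infinite set, then a code whose domain meets all these sets in infinite sets would not
belong to any piece of the covering. -/
theorem exists_uniform_approx (hOCA : OCA) [∀ n, Nonempty (M n)]
    (hpt : ∀ n, Function.Surjective (pt n)) (hmeet : MeetsInfinite dec Φ) {θ : ℝ} (hθ : 0 < θ) :
    ∃ g : ∀ n, M n → N n, ∀ e, Lifts dec Φ e →
      ∀ᶠ n in atTop, ∀ h, dec n (e n) = some h → ∀ x, dist (g n x) (h x) ≤ 2 * θ := by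
  classical
  obtain ⟨𝒞, hc, hH, hF⟩ := sigmaCovered_not_differ (pt := pt) (H := {e | Lifts dec Φ e}) hOCA
    (fun e he => he) hθ
  have hne : 𝒞.Nonempty := by
    obtain ⟨e, he, -⟩ := hmeet (fun _ => Set.univ) fun _ => Set.infinite_univ
    obtain ⟨F, hF, -⟩ := hH he
    exact ⟨F, hF⟩
  obtain ⟨F, rfl⟩ := hc.exists_eq_range hne
  let g : ℕ → ∀ n, M n → N n := fun k n =>
    if h : ∃ h, ∃ e ∈ F k, dec n (e n) = some h then h.choose
    else fun _ => Φ (fun n => Classical.arbitrary (M n)) n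
  have hg : ∀ k, ∀ e ∈ F k, ∀ n h, dec n (e n) = some h → ∀ x, dist (g k n x) (h x) ≤ θ := by
    intro k e he n h hh x
    have hex : ∃ h, ∃ e ∈ F k, dec n (e n) = some h := ⟨h, e, he, hh⟩
    obtain ⟨e', he', hh'⟩ := hex.choose_spec
    obtain ⟨i, rfl⟩ := hpt n x
    have hgk : g k n = hex.choose := dif_pos hex
    by_contra! hlt
    rw [hgk] at hlt
    exact hF _ ⟨k, rfl⟩ e' he' e he n i ⟨_, h, hh', hh, hlt⟩
  by_contra! hcon
  choose e he hbad using fun k => hcon (g k)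
  obtain ⟨e', he', -, hinf⟩ := hmeet _ fun k => Nat.frequently_atTop_iff_infinite.1 (hbad k)
  obtain ⟨_, ⟨k, rfl⟩, hk⟩ := hH he'
  obtain ⟨n, ⟨⟨h, hh, x, hx⟩, hs⟩, hn⟩ := ((Nat.frequently_atTop_iff_infinite.2
    (hinf k)).and_eventually ((he k).eventually_dist_le he' hθ)).exists
  obtain ⟨h', hh'⟩ := Option.isSome_iff_exists.1 hs
  have h1 := hn h h' hh hh' x
  have h2 := hg k e' hk n h' hh' x
  linarith [dist_triangle_right (g k n x) (h x) (h' x)]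

theorem exists_product_lifting (hOCA : OCA) [∀ n, Nonempty (M n)]
    (hpt : ∀ n, Function.Surjective (pt n)) (hmeet : MeetsInfinite dec Φ) :
    ∃ g : ∀ n, M n → N n, ∀ a : ∀ n, M n, ∀ δ > 0,
      ∀ᶠ n in atTop, dist (Φ a n) (g n (a n)) ≤ δ := by
  classical
  let δ : ℕ → ℝ := fun s => 1 / ((s : ℝ) + 1)
  have hδ : ∀ s, 0 < δ s := fun s => Nat.one_div_pos_of_nat
  have hδanti : ∀ s r, s ≤ r → δ r ≤ δ s := fun s r h => Nat.one_div_le_one_div h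
  have happrox : ∀ s, ∃ g : ∀ n, M n → N n, ∀ e, Lifts dec Φ e →
      ∀ᶠ n in atTop, ∀ h, dec n (e n) = some h → ∀ x, dist (g n x) (h x) ≤ δ s := fun s => by
    obtain ⟨g, hg⟩ := exists_uniform_approx hOCA hpt hmeet (half_pos (hδ s))
    exact ⟨g, by simpa only [mul_div_cancel₀ (δ s) (two_ne_zero)] using hg⟩
  choose g hg using happrox
  have hΦ : ∀ s (a : ∀ n, M n), ∀ᶠ n in atTop, dist (Φ a n) (g s n (a n)) ≤ 2 * δ s := by
    intro s a
    refine hmeet.eventually fun e he => ?_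
    filter_upwards [he a _ (hδ s), hg s e he] with n h1 h2 h hh
    linarith [h1 h hh, h2 h hh (a n), dist_triangle_right (Φ a n) (g s n (a n)) (h (a n))]
  -- `good r n`: at `n`, all the approximations up to the `r`-th are compatible with the `r`-th.
  let good : ℕ → ℕ → Prop := fun r n => ∀ s ∈ Finset.range (r + 1), ∀ x,
    dist (g s n x) (g r n x) ≤ 2 * δ s
  have hgood : ∀ r, ∀ᶠ n in atTop, good r n := by
    intro r
    refine (Finset.eventually_all _).2 fun s hs => hmeet.eventually fun e he => ?_
    filter_upwards [hg s e he, hg r e he] with n h1 h2 h hh x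
    linarith [h1 h hh x, h2 h hh x, dist_triangle_right (g s n x) (g r n x) (h x),
      hδanti s r (Nat.lt_succ_iff.1 (Finset.mem_range.1 hs))]
  have hgood0 : ∀ n, good 0 n := by
    intro n s hs x
    obtain rfl : s = 0 := by simpa using hs
    rw [dist_self]
    linarith [hδ 0]
  refine ⟨fun n => g (Nat.findGreatest (fun r => good r n) n) n, fun a ε hε => ?_⟩
  obtain ⟨s, hs⟩ := exists_nat_one_div_lt (show 0 < ε / 4 by positivity)
  filter_upwards [hΦ s a, hgood s, eventually_ge_atTop s] with n h1 h2 h3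
  have h4 : good (Nat.findGreatest (fun r => good r n) n) n :=
    Nat.findGreatest_spec (P := fun r => good r n) (Nat.zero_le n) (hgood0 n)
  have h5 := h4 s (Finset.mem_range.2 (Nat.lt_succ_of_le (Nat.le_findGreatest h3 h2))) (a n)
  have hs : δ s < ε / 4 := hs
  linarith [dist_triangle (Φ a n) (g s n (a n))
    (g (Nat.findGreatest (fun r => good r n) n) n (a n))]

end

/-! ### Reduced products -/

section

variable {M N : ℕ → Type*} [∀ n, MetricSpace (N n)]

theorem limsupDist_le_zero_iff {A : Set ℕ} {a b : ∀ n, N n} :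
    limsupDist A a b ≤ 0 ↔ ∀ δ > 0, ∀ᶠ n in atTop, n ∈ A → dist (a n) (b n) ≤ δ := by
  constructor
  · intro h δ hδ
    have h1 : limsupDist A a b < ENNReal.ofReal δ := h.trans_lt (ENNReal.ofReal_pos.2 hδ)
    filter_upwards [eventually_inf_principal.1 (eventually_lt_of_limsup_lt h1)] with n hn hA
    have := (hn hA).le
    rwa [edist_dist, ENNReal.ofReal_le_ofReal_iff hδ.le] at this
  · intro h
    refine ENNReal.le_of_forall_pos_le_add fun δ hδ _ => ?_
    rw [zero_add]
    refine limsup_le_of_le (by isBoundedDefault) (eventually_inf_principal.2 ?_)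
    filter_upwards [h δ hδ] with n hn hA
    rw [edist_dist]
    exact ENNReal.ofReal_le_of_le_toReal (hn hA)

/-- Since `M n` is finite and `N n` is separable, maps `M n → N n` can be coded by natural numbers up
to arbitrarily small errors. -/
theorem exists_dense_coding [∀ n, Finite (M n)] [∀ n, TopologicalSpace.SeparableSpace (N n)]
    [∀ n, Nonempty (N n)] :
    ∃ dec : ∀ n, ℕ → Option (M n → N n), (∀ n, ∃ k, dec n k = none) ∧
      ∀ n (h : M n → N n) (δ : ℝ), 0 < δ → ∃ k h', dec n k = some h' ∧
        ∀ x, dist (h x) (h' x) < δ := by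
  choose f hf using fun n => exists_surjective_nat (Option (M n → ℕ))
  refine ⟨fun n k => (f n k).map fun s x => TopologicalSpace.denseSeq (N n) (s x),
    fun n => ?_, fun n h δ hδ => ?_⟩
  · obtain ⟨k, hk⟩ := hf n none
    exact ⟨k, by simp [hk]⟩
  · have : ∀ x, ∃ i, dist (h x) (TopologicalSpace.denseSeq (N n) i) < δ := fun x =>
      (TopologicalSpace.denseRange_denseSeq (N n)).exists_dist_lt (h x) hδ
    choose s hs using this
    obtain ⟨k, hk⟩ := hf n (some s)
    exact ⟨k, fun x => TopologicalSpace.denseSeq (N n) (s x), by simp [hk], hs⟩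

theorem exists_lifts_of_mem_jProd {dec : ∀ n, ℕ → Option (M n → N n)} [∀ n, MetricSpace (M n)]
    (hnone : ∀ n, ∃ k, dec n k = none)
    (hdense : ∀ n (h : M n → N n) (δ : ℝ), 0 < δ → ∃ k h', dec n k = some h' ∧
      ∀ x, dist (h x) (h' x) < δ)
    {Φ : (∀ n, M n) → ∀ n, N n} {A : Set ℕ} (hA : A ∈ JProd Φ) :
    ∃ e, Lifts dec Φ e ∧ ∀ n, (dec n (e n)).isSome ↔ n ∈ A := by
  classical
  obtain ⟨h, hh⟩ := hA
  have hcode : ∀ n, ∃ k, (n ∉ A → dec n k = none) ∧ (n ∈ A → ∃ h', dec n k = some h' ∧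
      ∀ x, dist (h n x) (h' x) < 1 / ((n : ℝ) + 1)) := by
    intro n
    by_cases hn : n ∈ A
    · obtain ⟨k, hk⟩ := hdense n (h n) _ (Nat.one_div_pos_of_nat (n := n))
      exact ⟨k, fun h => absurd hn h, fun _ => hk⟩
    · obtain ⟨k, hk⟩ := hnone n
      exact ⟨k, fun _ => hk, fun h => absurd h hn⟩
  choose e he1 he2 using hcode
  have hdom : ∀ n, (dec n (e n)).isSome ↔ n ∈ A := by
    intro n
    by_cases hn : n ∈ A
    · obtain ⟨h', hh', -⟩ := he2 n hn
      simp [hh', hn]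
    · simp [he1 n hn, hn]
  refine ⟨e, fun a δ hδ => ?_, hdom⟩
  have h1 := limsupDist_le_zero_iff.1 (by simpa using hh a) (δ / 2) (half_pos hδ)
  have h2 : ∀ᶠ n : ℕ in atTop, 1 / ((n : ℝ) + 1) < δ / 2 :=
    tendsto_one_div_add_atTop_nhds_zero_nat.eventually_lt_const (half_pos hδ)
  filter_upwards [h1, h2] with n h1 h2 f hf
  have hn : n ∈ A := (hdom n).1 (by simp [hf])
  obtain ⟨f', hf', hd⟩ := he2 n hn
  obtain rfl : f' = f := Option.some.inj (hf'.symm.trans hf)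
  linarith [h1 hn, hd (a n), dist_triangle (Φ a n) (h n (a n)) (f' (a n))]

theorem exists_product_lifting_of_jProd (hOCA : OCA) [∀ n, MetricSpace (M n)] [∀ n, Finite (M n)]
    [∀ n, TopologicalSpace.SeparableSpace (N n)] {Φ : (∀ n, M n) → ∀ n, N n}
    (hJ : ∀ 𝒜 : Set (Set ℕ), ¬ 𝒜.Countable → AlmostDisjoint 𝒜 → (JProd Φ ∩ 𝒜).Nonempty) :
    ∃ g : ∀ n, M n → N n, ∀ a : ∀ n, M n, ∀ δ > 0,
      ∀ᶠ n in atTop, dist (Φ a n) (g n (a n)) ≤ δ := by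
  have hmeetJ : ∀ B : ℕ → Set ℕ, (∀ k, (B k).Infinite) → ∃ A ∈ JProd Φ, A ⊆ ⋃ k, B k ∧
      ∀ k, (A ∩ B k).Infinite := fun B hB => by
    obtain ⟨𝒜, hc, had, h𝒜⟩ := exists_almostDisjoint_inter_infinite hB
    obtain ⟨A, hAJ, hA⟩ := hJ 𝒜 hc had
    exact ⟨A, hAJ, h𝒜 A hA⟩
  by_cases hne : ∀ n, Nonempty (M n)
  · have : ∀ n, Nonempty (N n) := fun n => ⟨Φ (fun n => Classical.arbitrary (M n)) n⟩
    obtain ⟨dec, hnone, hdense⟩ := exists_dense_coding (M := M) (N := N)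
    choose pt hpt using fun n => exists_surjective_nat (M n)
    refine exists_product_lifting (dec := dec) hOCA hpt fun B hB => ?_
    obtain ⟨A, hAJ, hAB, hA⟩ := hmeetJ B hB
    obtain ⟨e, he, hdom⟩ := exists_lifts_of_mem_jProd hnone hdense hAJ
    refine ⟨e, he, fun n hn => hAB ((hdom n).1 hn), fun k => (hA k).mono ?_⟩
    exact fun n hn => ⟨hn.2, (hdom n).2 hn.1⟩
  · -- If the product of the `M n` is empty, then it only matters that maps `M n → N n` exist.
    obtain ⟨A, ⟨h, -⟩, -⟩ := hmeetJ (fun _ => Set.univ) fun _ => Set.infinite_univ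
    exact ⟨h, fun a => absurd (fun n => ⟨a n⟩) hne⟩

end

end ReducedProd

theorem proposition2p7 (hOCA : ReducedProd.OCA)
    {M N : ℕ → Type*} [∀ n, MetricSpace (M n)] [∀ n, MetricSpace (N n)]
    [∀ n, Finite (M n)] [∀ n, TopologicalSpace.SeparableSpace (N n)]
    (hM : ∃ C : ℝ, ∀ (n : ℕ) (x y : M n), dist x y ≤ C)
    (φ : ReducedProd.RedProd M → ReducedProd.RedProd N)
    (hφ : ReducedProd.CoordinateRespecting φ)
    (Φ : (∀ n, M n) → ∀ n, N n) (hΦ : ReducedProd.IsLifting φ Φ)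
    (hJ : ∀ 𝒜 : Set (Set ℕ), ¬ 𝒜.Countable → ReducedProd.AlmostDisjoint 𝒜 →
      (ReducedProd.JProd Φ ∩ 𝒜).Nonempty) :
    Set.univ ∈ ReducedProd.JProd Φ ∧
      ∃ h : ∀ n, M n → N n, ReducedProd.IsLifting φ (fun a n => h n (a n)) := by
  obtain ⟨g, hg⟩ := ReducedProd.exists_product_lifting_of_jProd hOCA hJ
  refine ⟨⟨g, fun a => ?_⟩, g, fun a => ?_⟩
  · simpa using ReducedProd.limsupDist_le_zero_iff.2 fun δ hδ => (hg a δ hδ).mono fun n hn _ => hn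
  · rw [hΦ a]
    refine Quotient.sound (show Tendsto _ _ _ from ?_)
    refine Metric.tendsto_atTop.2 fun ε hε => ?_
    obtain ⟨K, hK⟩ := eventually_atTop.1 (hg a (ε / 2) (half_pos hε))
    refine ⟨K, fun n hn => ?_⟩
    rw [dist_zero_right, Real.norm_of_nonneg dist_nonneg]
    linarith [hK n hn]
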